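/- Let $K$ be a quartic CM field with real quadratic subfield $K_0$, and let $\Phi=\{\phi_1,\phi_2\}$ be a CM-type of $K$ (two complex embeddings that are neither equal nor complex conjugate), with $\Phi(z)=(\phi_1(z),\phi_2(z))\in\mathbb C^2$. An element $a\in K_0$ acts on $\mathbb C^2$ by $a\cdot(z_1,z_2)=(\phi_1(a)z_1,\phi_2(a)z_2)$. Let $\Lambda=\Lambda_1+\Lambda_2\tau$, where $\Lambda_1,\Lambda_2$ are nonzero fractional ideals of $K_0$ and $\tau\in K$ satisfies $\operatorname{Im}\phi_r(\tau)>0$ for $r=1,2$, and put $J_1=\mathbb C^2/\Phi(\Lambda)$. For $\xi\in K_0$ let $$H_\xi(z,w)=\sum_{r=1}^2\frac{\phi_r(\xi)\,z_r\overline{w_r}}{\operatorname{Im}\phi_r(\tau)} .$$ For a complex torus $V/L$, the dual torus $\widehat{V/L}$ is the quotient of the space of antilinear functionals on $V$ by the group of those functionals whose imaginary part is integer valued on $L$. The dual of a homomorphism is induced by precomposition. If $\operatorname{Im}H$ is integer valued on $L$, then $v\mapsto H(v,\cdot)$ induces a homomorphism $V/L\to\widehat{V/L}$. When $V=\mathbb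 C^2$ and $H=H_\xi$ it is denoted $\lambda_\xi$. Let $\ell$ be a prime number with $\ell\mathcal O_{K_0}=\mathfrak l_1\mathfrak l_2$, where $\mathfrak l_i=\alpha_i\mathcal O_{K_0}$ are prime ideals and the generators are chosen so that $\alpha_1\alpha_2=\ell$. Let $\xi\in K_0$ be such that $H_\xi$ is a Riemann form on $J_1$ (a positive definite Hermitian form with $\operatorname{Im}H_\xi$ integer valued on $\Phi(\Lambda)$). Let $I:J_1\to J_2=\mathbb C^2/L_2$, $z\mapsto z$, with $L_2\supseteq\Phi(\Lambda)$, be an $\alpha_1$-isogeny, i.e. $\ker I$ is cyclic of order $\ell$ and contained in $J_1[\alpha_1]$. Then $L_2$ is stable under $\mathcal O_{K_0}$, so that $\mathcal O_{K_0}$ acts on $J_2$ and, by duality, on $\hat J_2$. Moreover $\operatorname{Im}H_{\alpha_1\xi}$ is integer valued on $L_2$, so that $\lambda_{\alpha_1\xi}:J_2\to\hat J_2$ is defined. A homomorphism $\lambda_I:J_2\to\hat J_2$ satisfies $$\hat I\circ\lambda_I\circ I=\ell\,\lambda_\xi$$ if and only if $\lambda_I=\alpha_2\circ\lambda_{\alpha_1\xi}$.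 In other words, there is exactly one such $\lambda_I$, and it is $\alpha_2\circ\lambda_{\alpha_1\xi}$. If $\alpha_1$ is totally positive, then $H_{\alpha_1\xi}$ is a Riemann form on $J_2$, so $\lambda_{\alpha_1\xi}$ is a polarization. If $\lambda_\xi$ is an isomorphism, then so is $\lambda_{\alpha_1\xi}$. -/

import Mathlib

open NumberField
open scoped ComplexConjugate nonZeroDivisors

noncomputable section

namespace RMIsogeny

/-! ### Complex tori, their homomorphisms and their duals -/

section Tori

variable {V W : Type*} [AddCommGroup V] [Module ℂ V] [AddCommGroup W] [Module ℂ W]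

/-- The complex torus `V / L`. -/
abbrev Torus (L : Submodule ℤ V) : Type _ := V ⧸ L

/-- The homomorphism `V / L → W / M` of complex tori induced by a `ℂ`-linear map `F : V → W`
with `F L ⊆ M` (its analytic representation). -/
def torusHom (L : Submodule ℤ V) (M : Submodule ℤ W) (F : V →ₗ[ℂ] W)
    (h : L ≤ M.comap (F.restrictScalars ℤ)) : Torus L →ₗ[ℤ] Torus M :=
  Submodule.mapQ L M (F.restrictScalars ℤ) h

/-- The space of `ℂ`-antilinear functionals on `V`, the tangent space of the dual torus. -/
abbrev AntiDual (V : Type*) [AddCommGroup V] [Module ℂ V] : Type _ := V →ₗ⋆[ℂ] ℂ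

/-- The dual lattice of `L`: the antilinear functionals whose imaginary part is integer valued
on `L`. -/
def dualLattice (L : Submodule ℤ V) : Submodule ℤ (AntiDual V) where
  carrier := {f | ∀ v ∈ L, ∃ n : ℤ, (f v).im = n}
  add_mem' := by
    intro f g hf hg v hv
    obtain ⟨a, ha⟩ := hf v hv
    obtain ⟨b, hb⟩ := hg v hv
    exact ⟨a + b, by simp [ha, hb]⟩
  zero_mem' := fun v _ => ⟨0, by simp⟩
  smul_mem' := by
    intro c f hf v hv
    obtain ⟨a, ha⟩ := hf v hv
    exact ⟨c * a, by simp [ha]⟩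

/-- The dual `(V / L)^` of the complex torus `V / L`. -/
abbrev DualTorus (L : Submodule ℤ V) : Type _ := Torus (dualLattice L)

/-- Precomposition of antilinear functionals with a `ℂ`-linear map. -/
def antiTranspose (F : V →ₗ[ℂ] W) : AntiDual W →ₗ[ℂ] AntiDual V where
  toFun f := f.comp F
  map_add' _ _ := rfl
  map_smul' _ _ := rfl

theorem dualLattice_le_comap (L : Submodule ℤ V) (M : Submodule ℤ W) (F : V →ₗ[ℂ] W)
    (h : L ≤ M.comap (F.restrictScalars ℤ)) :
    dualLattice M ≤ (dualLattice L).comap ((antiTranspose F).restrictScalars ℤ) :=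
  fun _ hf v hv => hf (F v) (h hv)

/-- The dual homomorphism `(W / M)^ → (V / L)^` of the homomorphism induced by `F`. -/
def dualHom (L : Submodule ℤ V) (M : Submodule ℤ W) (F : V →ₗ[ℂ] W)
    (h : L ≤ M.comap (F.restrictScalars ℤ)) : DualTorus M →ₗ[ℤ] DualTorus L :=
  torusHom (dualLattice M) (dualLattice L) (antiTranspose F) (dualLattice_le_comap L M F h)

/-- The imaginary part of the sesquilinear form `H` is integer valued on `L`. -/
def IsIntegralOn (L : Submodule ℤ V) (H : V →ₗ[ℂ] AntiDual V) : Prop :=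
  L ≤ (dualLattice L).comap (H.restrictScalars ℤ)

/-- The homomorphism `V / L → (V / L)^`, `v ↦ H(v, ·)`, attached to a form `H` whose imaginary
part is integer valued on `L`. -/
def formHom (L : Submodule ℤ V) (H : V →ₗ[ℂ] AntiDual V) (h : IsIntegralOn L H) :
    Torus L →ₗ[ℤ] DualTorus L :=
  torusHom L (dualLattice L) H h

/-- `H` is a Riemann form (a polarization) on `V / L`: a positive definite Hermitian form whose
imaginary part is integer valued on `L`. -/
structure IsRiemannForm (L : Submodule ℤ V) (H : V →ₗ[ℂ] AntiDual V) : Prop where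
  hermitian : ∀ v w, H w v = conj (H v w)
  pos : ∀ v, v ≠ 0 → 0 < (H v v).re
  integral : IsIntegralOn L H

end Tori

/-! ### Abelian surfaces with real multiplication inside a quartic CM field -/

section CM

variable {K₀ K : Type*} [Field K₀] [NumberField K₀] [Field K] [NumberField K] [Algebra K₀ K]

/-- A CM-type of a quartic CM field `K`: two complex embeddings of `K` that are neither equal nor
complex conjugate. -/
structure CMType (K : Type*) [Field K] where
  emb : Fin 2 → K →+* ℂ
  ne : emb 0 ≠ emb 1
  ne_conj : emb 0 ≠ ComplexEmbedding.conjugate (emb 1)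

/-- The map `Φ : K → ℂ²`, `z ↦ (φ₁ z, φ₂ z)`. -/
def CMType.toVec (Φ : CMType K) : K →ₗ[ℤ] (Fin 2 → ℂ) where
  toFun z r := Φ.emb r z
  map_add' x y := by ext r; simp
  map_smul' c x := by ext r; simp

/-- Multiplication by `a ∈ K₀` on `ℂ²`, through `Φ`. -/
def mulBy (Φ : CMType K) (a : K₀) : (Fin 2 → ℂ) →ₗ[ℂ] (Fin 2 → ℂ) where
  toFun v r := Φ.emb r (algebraMap K₀ K a) * v r
  map_add' v w := by ext r; simp [mul_add]
  map_smul' c v := by ext r; simp [mul_left_comm]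

/-- The `𝓞 K₀`-lattice `Λ₁ + Λ₂ τ` in `K`. -/
def lattice (Λ₁ Λ₂ : FractionalIdeal (𝓞 K₀)⁰ K₀) (τ : K) : Submodule ℤ K where
  carrier := {z | ∃ x ∈ (Λ₁ : Submodule (𝓞 K₀) K₀), ∃ y ∈ (Λ₂ : Submodule (𝓞 K₀) K₀),
    z = algebraMap K₀ K x + algebraMap K₀ K y * τ}
  add_mem' := by
    rintro _ _ ⟨x, hx, y, hy, rfl⟩ ⟨x', hx', y', hy', rfl⟩
    exact ⟨x + x', add_mem hx hx', y + y', add_mem hy hy', by simp only [map_add]; ring⟩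
  zero_mem' := ⟨0, zero_mem _, 0, zero_mem _, by simp⟩
  smul_mem' := by
    rintro c _ ⟨x, hx, y, hy, rfl⟩
    exact ⟨c • x, zsmul_mem hx c, c • y, zsmul_mem hy c, by
      simp only [map_zsmul, smul_add, smul_mul_assoc]⟩

/-- The period lattice `Φ(Λ₁ + Λ₂ τ)` in `ℂ²`. -/
def periods (Φ : CMType K) (Λ₁ Λ₂ : FractionalIdeal (𝓞 K₀)⁰ K₀) (τ : K) :
    Submodule ℤ (Fin 2 → ℂ) :=
  (lattice Λ₁ Λ₂ τ).map Φ.toVec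

/-- A subgroup `L` of `ℂ²` is stable under `𝓞 K₀`, so that `𝓞 K₀` acts on `ℂ² / L`. -/
def HasRM (K₀ : Type*) [Field K₀] [NumberField K₀] [Algebra K₀ K] (Φ : CMType K)
    (L : Submodule ℤ (Fin 2 → ℂ)) : Prop :=
  ∀ a : 𝓞 K₀, L ≤ L.comap ((mulBy Φ (a : K₀)).restrictScalars ℤ)

theorem hasRM_periods (Φ : CMType K) (Λ₁ Λ₂ : FractionalIdeal (𝓞 K₀)⁰ K₀) (τ : K) :
    HasRM K₀ Φ (periods Φ Λ₁ Λ₂ τ) := by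
  rintro a _ ⟨_, ⟨x, hx, y, hy, rfl⟩, rfl⟩
  refine ⟨_, ⟨(a : K₀) * x, ?_, (a : K₀) * y, ?_, rfl⟩, ?_⟩
  · have h := Submodule.smul_mem (Λ₁ : Submodule (𝓞 K₀) K₀) a hx
    rw [Algebra.smul_def] at h
    exact h
  · have h := Submodule.smul_mem (Λ₂ : Submodule (𝓞 K₀) K₀) a hy
    rw [Algebra.smul_def] at h
    exact h
  · ext r
    simp only [CMType.toVec, mulBy, LinearMap.coe_mk, AddHom.coe_mk, LinearMap.coe_restrictScalars,
      Pi.add_apply, map_add, map_mul]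
    ring

/-- The endomorphism `[a]` of `ℂ² / L` given by `a ∈ 𝓞 K₀`. -/
def rmEnd (Φ : CMType K) (L : Submodule ℤ (Fin 2 → ℂ)) (hL : HasRM K₀ Φ L) (a : 𝓞 K₀) :
    Torus L →ₗ[ℤ] Torus L :=
  torusHom L L (mulBy Φ (a : K₀)) (hL a)

/-- The action of `a ∈ 𝓞 K₀` on the dual torus `(ℂ² / L)^`: the dual of the endomorphism `[a]`. -/
def rmEndDual (Φ : CMType K) (L : Submodule ℤ (Fin 2 → ℂ)) (hL : HasRM K₀ Φ L) (a : 𝓞 K₀) :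
    DualTorus L →ₗ[ℤ] DualTorus L :=
  dualHom L L (mulBy Φ (a : K₀)) (hL a)

/-- The Hermitian form `H_ξ(z, w) = ∑ᵣ φᵣ(ξ) zᵣ conj(wᵣ) / Im φᵣ(τ)` on `ℂ²`. -/
def hForm (Φ : CMType K) (τ : K) (ξ : K₀) : (Fin 2 → ℂ) →ₗ[ℂ] AntiDual (Fin 2 → ℂ) :=
  LinearMap.mk₂'ₛₗ (RingHom.id ℂ) (starRingEnd ℂ)
    (fun z w => ∑ r, Φ.emb r (algebraMap K₀ K ξ) * z r * conj (w r) / ((Φ.emb r τ).im : ℂ))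
    (by intro z z' w; rw [← Finset.sum_add_distrib]
        exact Finset.sum_congr rfl fun r _ => by simp only [Pi.add_apply]; ring)
    (by intro c z w; rw [Finset.smul_sum]
        exact Finset.sum_congr rfl fun r _ => by
          simp only [Pi.smul_apply, smul_eq_mul, RingHom.id_apply]; ring)
    (by intro z w w'; rw [← Finset.sum_add_distrib]
        exact Finset.sum_congr rfl fun r _ => by simp only [Pi.add_apply, map_add]; ring)
    (by intro c z w; rw [Finset.smul_sum]
        exact Finset.sum_congr rfl fun r _ => by
          simp only [Pi.smul_apply, smul_eq_mul, map_mul]; ring)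

/-- The projection `ℂ² / L₁ → ℂ² / L₂`, `z ↦ z`, for `L₁ ⊆ L₂`. -/
def proj (L₁ L₂ : Submodule ℤ (Fin 2 → ℂ)) (h : L₁ ≤ L₂) : Torus L₁ →ₗ[ℤ] Torus L₂ :=
  torusHom L₁ L₂ LinearMap.id h

/-- The dual `(ℂ² / L₂)^ → (ℂ² / L₁)^` of the projection `ℂ² / L₁ → ℂ² / L₂`. -/
def dualProj (L₁ L₂ : Submodule ℤ (Fin 2 → ℂ)) (h : L₁ ≤ L₂) :
    DualTorus L₂ →ₗ[ℤ] DualTorus L₁ :=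
  dualHom L₁ L₂ LinearMap.id h

/-- The projection `ℂ² / L₁ → ℂ² / L₂`, `z ↦ z`, is an `α`-isogeny (`α` a generator of a prime
ideal of norm `ℓ`): its kernel is a cyclic group of order `ℓ` contained in the `α`-torsion. -/
structure IsAlphaIsogeny (Φ : CMType K) (ℓ : ℕ) (α : 𝓞 K₀) (L₁ L₂ : Submodule ℤ (Fin 2 → ℂ))
    (hRM : HasRM K₀ Φ L₁) (h : L₁ ≤ L₂) : Prop where
  cyclic : IsAddCyclic (LinearMap.ker (proj L₁ L₂ h))
  card : Nat.card (LinearMap.ker (proj L₁ L₂ h)) = ℓ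
  torsion : ∀ x ∈ LinearMap.ker (proj L₁ L₂ h), rmEnd Φ L₁ hRM α x = 0

/-- `x ∈ K₀` is totally positive (for `K₀` totally real). -/
def IsTotallyPos (x : K₀) : Prop := ∀ σ : K₀ →+* ℝ, 0 < σ x

end CM

end RMIsogeny

end

/-! Write `L₁` for the periods of `J₁` and `E_ξ = Im H_ξ`. As `K₀` is totally real, multiplication
by `a ∈ K₀` is self-adjoint: `H_{aξ}(z, w) = H_ξ(az, w) = H_ξ(z, aw)`. The kernel `L₂ / L₁` is
generated by a single `v₀`, and `α₁ L₂ ⊆ L₁`.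

The ideal `𝔩₁` has norm `ℓ`, so every integer of `K₀` is a rational integer modulo `α₁`; hence `L₂`
is stable. On `L₂ = L₁ + ℤ v₀` the form `E_{α₁ξ}` is integral: it vanishes on `(v₀, v₀)`, and
elsewhere `α₁` can be moved onto an argument in `L₂`.

The identity for `λ_I` is `H_{α₁ξ}(v, α₂ w) = ℓ H_ξ(v, w)`. Uniqueness holds because pullback along
an isogeny is injective: tori are divisible and the dual isogeny has torsion kernel
(`dualProj_comp_comp_proj_injective`).

For principality put `N = α₁⁻¹ L₁`. The quotient `N / L₁` is spanned over `𝔽_ℓ` by two elements, and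
`E_{α₁ξ}` induces on it a nondegenerate alternating form modulo `ℤ`. There `L₂ / L₁` is a line,
hence its own orthogonal (`exists_sub_zsmul_mem_of_alternating`), so `L₂` is self-dual for
`E_{α₁ξ}`. -/

namespace RMIsogeny

/-! ### Residues modulo a prime of norm `ℓ` -/

section NumberTheory

variable {R : Type*} [CommRing R]

/-- The residue ring has prime order, so `1` generates its additive group. -/
theorem exists_int_add_mul_of_card_prime {ℓ : ℕ} (hℓ : ℓ.Prime) (α : R)
    (hcard : Nat.card (R ⧸ Ideal.span {α}) = ℓ) (a : R) : ∃ (n : ℤ) (b : R), a = n + α * b := by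
  have : Fact ℓ.Prime := ⟨hℓ⟩
  have hne : (1 : R ⧸ Ideal.span {α}) ≠ 0 := by
    intro h
    have := subsingleton_of_zero_eq_one h.symm
    rw [Nat.card_of_subsingleton 0] at hcard
    exact hℓ.one_lt.ne hcard
  obtain ⟨n, hn⟩ := AddSubgroup.mem_zmultiples_iff.mp
    (mem_zmultiples_of_prime_card (p := ℓ) hcard hne (g' := Ideal.Quotient.mk _ a))
  have h : Ideal.Quotient.mk (Ideal.span {α}) (a - n) = 0 := by
    rw [map_sub, ← hn]; simp
  obtain ⟨b, hb⟩ := Ideal.mem_span_singleton'.mp (Ideal.Quotient.eq_zero_iff_mem.mp h)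
  exact ⟨n, b, by rw [mul_comm, hb]; ring⟩

/-- The norms multiply to `ℓ ^ 2` and neither is `1`. The ramified case `I = J` is included. -/
theorem absNorm_eq_of_mul_eq_span {K : Type*} [Field K] [NumberField K]
    (hdeg : Module.finrank ℚ K = 2) {ℓ : ℕ} (hℓ : ℓ.Prime) {I J : Ideal (𝓞 K)}
    (hI : I ≠ ⊤) (hJ : J ≠ ⊤) (h : Ideal.span {(ℓ : 𝓞 K)} = I * J) : Ideal.absNorm I = ℓ := by
  have h1 : Ideal.absNorm I * Ideal.absNorm J = ℓ ^ 2 := by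
    rw [← map_mul, ← h, Ideal.absNorm_span_singleton]
    have : (ℓ : 𝓞 K) = algebraMap ℤ (𝓞 K) ℓ := by simp
    rw [this, Algebra.norm_algebraMap, RingOfIntegers.rank, hdeg]
    simp
  exact ((hℓ.mul_eq_prime_sq_iff (mt Ideal.absNorm_eq_one_iff.mp hI)
    (mt Ideal.absNorm_eq_one_iff.mp hJ)).mp h1).1

/-- `I / αI` is one-dimensional over the residue field: no fractional ideal lies strictly between
`αI` and `I`, so any `x ∈ I` outside `αI` generates the quotient. -/
theorem exists_mem_eq_smul_add {A F : Type*} [CommRing A] [IsDedekindDomain A] [Field F]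
    [Algebra A F] [IsFractionRing A F] {α : A} (hmax : (Ideal.span {α}).IsMaximal)
    {I : FractionalIdeal A⁰ F} (hI : I ≠ 0) :
    ∃ x ∈ I, ∀ z ∈ I, ∃ a : A, ∃ y ∈ I, z = a • x + α • y := by
  set P : FractionalIdeal A⁰ F := FractionalIdeal.spanSingleton A⁰ (algebraMap A F α) with hP
  have hPspan : P = ((Ideal.span {α} : Ideal A) : FractionalIdeal A⁰ F) :=
    (FractionalIdeal.coeIdeal_span_singleton α).symm
  have hP1 : P ≤ 1 := hPspan ▸ FractionalIdeal.coeIdeal_le_one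
  have hlt : ¬ I ≤ P * I := by
    intro h
    have h1 : (1 : FractionalIdeal A⁰ F) ≤ P := by
      have := mul_le_mul_left h I⁻¹
      rwa [mul_assoc, mul_inv_cancel₀ hI, mul_one] at this
    have h2 : P = 1 := le_antisymm hP1 h1
    rw [hPspan, FractionalIdeal.coeIdeal_eq_one] at h2
    exact hmax.ne_top (h2.trans Ideal.one_eq_top)
  obtain ⟨x, hx, hxP⟩ := SetLike.not_le_iff_exists.mp hlt
  set M := FractionalIdeal.spanSingleton A⁰ x + P * I with hM
  have hPI : P * I ≤ I := by simpa using mul_le_mul_left hP1 I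
  have hMI : M ≤ I := sup_le (FractionalIdeal.spanSingleton_le_iff_mem.mpr hx) hPI
  have hMI1 : M * I⁻¹ ≤ 1 := by
    have := mul_le_mul_left hMI I⁻¹
    rwa [mul_inv_cancel₀ hI] at this
  -- Dividing by `I` turns `PI ≤ M ≤ I` into `P ≤ J ≤ 1`, where maximality of `P` applies.
  obtain ⟨J, hJ⟩ := FractionalIdeal.le_one_iff_exists_coeIdeal.mp hMI1
  have hPM : P ≤ M * I⁻¹ := by
    have := mul_le_mul_left (show P * I ≤ M from le_sup_right) I⁻¹
    rwa [mul_assoc, mul_inv_cancel₀ hI, mul_one] at this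
  have hPJ : Ideal.span {α} ≤ J := by
    rw [← hJ, hPspan] at hPM
    exact (FractionalIdeal.coeIdeal_le_coeIdeal F).mp hPM
  have hMeq : M = J * I := by rw [hJ, mul_assoc, inv_mul_cancel₀ hI, mul_one]
  have hJtop : J = ⊤ := by
    by_contra hne
    have hJP := hmax.eq_of_le hne hPJ
    rw [← hJP, ← hPspan] at hMeq
    exact hxP (hMeq ▸ (show FractionalIdeal.spanSingleton A⁰ x ≤ M from le_sup_left)
      (FractionalIdeal.mem_spanSingleton_self A⁰ x))
  refine ⟨x, hx, fun z hz => ?_⟩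
  have hz' : z ∈ M := by
    rw [hMeq, hJtop, FractionalIdeal.coeIdeal_top, one_mul]; exact hz
  rw [hM, FractionalIdeal.mem_add] at hz'
  obtain ⟨_, hi, _, hj, rfl⟩ := hz'
  obtain ⟨a, rfl⟩ := (FractionalIdeal.mem_spanSingleton A⁰).mp hi
  obtain ⟨y, hy, rfl⟩ := FractionalIdeal.mem_singleton_mul.mp hj
  exact ⟨a, y, hy, by rw [Algebra.smul_def α y]⟩

end NumberTheory

/-! ### Alternating forms on a plane over `𝔽_ℓ` -/

section Alternating

/-- A line in a plane carrying a nondegenerate alternating form with values in `ℝ / ℤ` is its own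
orthogonal. -/
theorem exists_sub_zsmul_mem_of_alternating {V : Type*} [AddCommGroup V] {ℓ : ℕ} (hℓ : ℓ.Prime)
    (E : V →ₗ[ℤ] V →ₗ[ℤ] ℝ) (hE : ∀ v, E v v = 0) (Z : AddSubgroup ℝ) (L : Submodule ℤ V)
    {e₁ e₂ : V} (he₁ : (ℓ : ℤ) • e₁ ∈ L) (he₂ : (ℓ : ℤ) • e₂ ∈ L)
    {N : Submodule ℤ V} (he₁N : e₁ ∈ N) (he₂N : e₂ ∈ N) (hLN : L ≤ N)
    (hN : ∀ v ∈ N, ∃ a b : ℤ, ∃ l ∈ L, v = a • e₁ + b • e₂ + l)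
    (hNL : ∀ v ∈ N, ∀ l ∈ L, E v l ∈ Z)
    {v w : V} (hv : v ∈ N) (hw : w ∈ N) (hnd : ∃ u ∈ N, E w u ∉ Z) (hvw : E v w ∈ Z) :
    ∃ n : ℤ, v - n • w ∈ L := by
  have hanti (x y : V) : E x y = - E y x := by
    have := hE (x + y)
    simp only [map_add, LinearMap.add_apply, hE] at this
    linarith
  have hLN' : ∀ l ∈ L, ∀ v ∈ N, E l v ∈ Z := fun l hl v hv => by
    rw [hanti]; exact neg_mem (hNL v hv l hl)
  -- Modulo `Z` the form is the determinant of the coordinates times `E e₁ e₂`.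
  have key (a b c d : ℤ) (l l' : V) (hl : l ∈ L) (hl' : l' ∈ L) :
      E (a • e₁ + b • e₂ + l) (c • e₁ + d • e₂ + l') - (a * d - b * c) • E e₁ e₂ ∈ Z := by
    have h1 : E (a • e₁ + b • e₂ + l) (c • e₁ + d • e₂ + l') - (a * d - b * c) • E e₁ e₂
        = E (a • e₁ + b • e₂ + l) l' + E l (c • e₁ + d • e₂) := by
      simp only [map_add, LinearMap.add_apply, map_zsmul, LinearMap.smul_apply, hE,
        hanti e₂ e₁, zsmul_eq_mul]
      push_cast
      ring
    rw [h1]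
    exact add_mem (hNL _ (add_mem (add_mem (N.smul_mem _ he₁N) (N.smul_mem _ he₂N)) (hLN hl)) _ hl')
      (hLN' _ hl _ (add_mem (N.smul_mem _ he₁N) (N.smul_mem _ he₂N)))
  obtain ⟨a, b, l, hl, rfl⟩ := hN v hv
  obtain ⟨c, d, m, hm, rfl⟩ := hN w hw
  obtain ⟨u, hu, huZ⟩ := hnd
  obtain ⟨a', b', l', hl', rfl⟩ := hN u hu
  set t := E e₁ e₂ with ht
  have htZ : t ∉ Z := fun h => huZ (by
    have := add_mem (key c d a' b' m l' hm hl') (zsmul_mem h (c * b' - d * a'))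
    rwa [sub_add_cancel] at this)
  have hℓt : (ℓ : ℤ) • t ∈ Z := by
    rw [ht, ← map_zsmul]; exact hNL _ he₁N _ he₂
  have hdet : (a * d - b * c) • t ∈ Z := by
    have := sub_mem hvw (key a b c d l m hl hm)
    rwa [sub_sub_cancel] at this
  have hprime : Prime (ℓ : ℤ) := Nat.prime_iff_prime_int.mp hℓ
  -- The class of `t` modulo `Z` has order exactly `ℓ`.
  have hdvd (k : ℤ) (hk : k • t ∈ Z) : (ℓ : ℤ) ∣ k := by
    by_contra hnd
    obtain ⟨x, y, hxy⟩ := (hprime.coprime_iff_not_dvd.mpr hnd)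
    apply htZ
    have : t = x • (ℓ : ℤ) • t + y • k • t := by
      rw [smul_smul, smul_smul, ← add_smul, hxy, one_smul]
    rw [this]
    exact add_mem (zsmul_mem hℓt _) (zsmul_mem hk _)
  have hdet' := hdvd _ hdet
  -- A vanishing determinant modulo `ℓ` makes `(a, b)` a multiple of the nonzero vector `(c, d)`.
  -- The Bézout coefficient `y` below inverts whichever of `c`, `d` is prime to `ℓ`.
  suffices h : ∃ n : ℤ, (ℓ : ℤ) ∣ a - n * c ∧ (ℓ : ℤ) ∣ b - n * d by
    obtain ⟨n, ⟨p, hp⟩, ⟨q, hq⟩⟩ := h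
    refine ⟨n, ?_⟩
    have : a • e₁ + b • e₂ + l - n • (c • e₁ + d • e₂ + m)
        = p • (ℓ : ℤ) • e₁ + q • (ℓ : ℤ) • e₂ + (l - n • m) := by
      rw [smul_smul, smul_smul, mul_comm p, mul_comm q, ← hp, ← hq]
      module
    rw [this]
    exact add_mem (add_mem (L.smul_mem _ he₁) (L.smul_mem _ he₂)) (sub_mem hl (L.smul_mem _ hm))
  by_cases hc : (ℓ : ℤ) ∣ c
  · have hd : ¬ (ℓ : ℤ) ∣ d := by
      rintro ⟨q, rfl⟩
      obtain ⟨p, rfl⟩ := hc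
      refine huZ ?_
      have := add_mem (key (ℓ * p) (ℓ * q) a' b' m l' hm hl') (zsmul_mem hℓt (p * b' - q * a'))
      rw [smul_smul] at this
      ring_nf at this ⊢
      exact this
    obtain ⟨x, y, hxy⟩ := (hprime.coprime_iff_not_dvd.mpr hd)
    refine ⟨b * y, ?_, ⟨b * x, by linear_combination (-b) * hxy⟩⟩
    have ha : (ℓ : ℤ) ∣ a := by
      refine (hprime.dvd_or_dvd (a := a) (b := d) ?_).resolve_right hd
      exact (Int.dvd_iff_dvd_of_dvd_sub hdet').mpr (hc.mul_left b)
    exact dvd_sub ha (hc.mul_left _)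
  · obtain ⟨x, y, hxy⟩ := (hprime.coprime_iff_not_dvd.mpr hc)
    refine ⟨a * y, ⟨a * x, by linear_combination (-a) * hxy⟩, ?_⟩
    obtain ⟨k, hk⟩ := hdet'
    exact ⟨b * x - y * k, by linear_combination (-b) * hxy - y * hk⟩

end Alternating

/-! ### The forms `H_ξ`: self-adjointness of `K₀`, positivity, integrality -/

section Forms

variable {K₀ K : Type*} [Field K₀] [Field K] [Algebra K₀ K]

theorem mulBy_mul (Φ : CMType K) (a b : K₀) (v : Fin 2 → ℂ) :
    mulBy Φ (a * b) v = mulBy Φ a (mulBy Φ b v) := by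
  ext r; simp [mulBy, mul_assoc]

theorem mulBy_add (Φ : CMType K) (a b : K₀) (v : Fin 2 → ℂ) :
    mulBy Φ (a + b) v = mulBy Φ a v + mulBy Φ b v := by
  ext r; simp [mulBy, add_mul]

theorem mulBy_intCast (Φ : CMType K) (n : ℤ) (v : Fin 2 → ℂ) :
    mulBy Φ (n : K₀) v = n • v := by
  ext r; simp [mulBy]

theorem mulBy_one (Φ : CMType K) (v : Fin 2 → ℂ) : mulBy Φ (1 : K₀) v = v := by
  ext r; simp [mulBy]

theorem mulBy_toVec [NumberField K] (Φ : CMType K) (a : K₀) (z : K) :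
    mulBy Φ a (Φ.toVec z) = Φ.toVec (algebraMap K₀ K a * z) := by
  ext r; simp [mulBy, CMType.toVec]

theorem hForm_apply (Φ : CMType K) (τ : K) (ξ : K₀) (z w : Fin 2 → ℂ) :
    hForm Φ τ ξ z w =
      ∑ r, Φ.emb r (algebraMap K₀ K ξ) * z r * conj (w r) / ((Φ.emb r τ).im : ℂ) := rfl

theorem conj_emb_algebraMap [NumberField K₀] [IsTotallyReal K₀] (Φ : CMType K) (r : Fin 2)
    (a : K₀) : conj (Φ.emb r (algebraMap K₀ K a)) = Φ.emb r (algebraMap K₀ K a) :=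
  RingHom.congr_fun (IsTotallyReal.complexEmbedding_isReal ((Φ.emb r).comp (algebraMap K₀ K))) a

theorem hForm_mul_left (Φ : CMType K) (τ : K) (a ξ : K₀) (z w : Fin 2 → ℂ) :
    hForm Φ τ (a * ξ) z w = hForm Φ τ ξ (mulBy Φ a z) w := by
  simp only [hForm_apply, mulBy, LinearMap.coe_mk, AddHom.coe_mk, map_mul]
  exact Finset.sum_congr rfl fun r _ => by ring

theorem hForm_mul_right [NumberField K₀] [IsTotallyReal K₀] (Φ : CMType K) (τ : K) (a ξ : K₀)
    (z w : Fin 2 → ℂ) : hForm Φ τ (a * ξ) z w = hForm Φ τ ξ z (mulBy Φ a w) := by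
  simp only [hForm_apply, mulBy, LinearMap.coe_mk, AddHom.coe_mk, map_mul, conj_emb_algebraMap]
  exact Finset.sum_congr rfl fun r _ => by ring

theorem hForm_conj [NumberField K₀] [IsTotallyReal K₀] (Φ : CMType K) (τ : K) (ξ : K₀)
    (z w : Fin 2 → ℂ) : hForm Φ τ ξ w z = conj (hForm Φ τ ξ z w) := by
  simp only [hForm_apply, map_sum, map_mul, map_div₀, conj_emb_algebraMap, Complex.conj_conj,
    Complex.conj_ofReal]
  exact Finset.sum_congr rfl fun r _ => by ring

theorem hForm_self_im [NumberField K₀] [IsTotallyReal K₀] (Φ : CMType K) (τ : K) (ξ : K₀)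
    (z : Fin 2 → ℂ) : (hForm Φ τ ξ z z).im = 0 :=
  Complex.conj_eq_iff_im.mp (hForm_conj Φ τ ξ z z).symm

theorem hForm_single_self (Φ : CMType K) (τ : K) (ξ : K₀) (r : Fin 2) :
    hForm Φ τ ξ (Pi.single r 1) (Pi.single r 1) =
      Φ.emb r (algebraMap K₀ K ξ) / ((Φ.emb r τ).im : ℂ) := by
  rw [hForm_apply, Finset.sum_eq_single r]
  · simp
  · intro s _ hs; simp [hs]
  · simp

theorem emb_re_pos_of_isRiemannForm {Φ : CMType K} {τ : K} {ξ : K₀}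
    {L : Submodule ℤ (Fin 2 → ℂ)} (h : IsRiemannForm L (hForm Φ τ ξ))
    (hτ : ∀ r, 0 < (Φ.emb r τ).im) (r : Fin 2) : 0 < (Φ.emb r (algebraMap K₀ K ξ)).re := by
  have h1 := h.pos (Pi.single r 1) (by simp)
  rw [hForm_single_self, Complex.div_ofReal_re] at h1
  exact (div_pos_iff_of_pos_right (hτ r)).mp h1

theorem emb_re_pos_of_isTotallyPos [NumberField K₀] [IsTotallyReal K₀] (Φ : CMType K) {a : K₀}
    (ha : IsTotallyPos a) (r : Fin 2) : 0 < (Φ.emb r (algebraMap K₀ K a)).re :=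
  ha (IsTotallyReal.complexEmbedding_isReal ((Φ.emb r).comp (algebraMap K₀ K))).embedding

theorem hForm_pos [NumberField K₀] [IsTotallyReal K₀] {Φ : CMType K} {τ : K}
    (hτ : ∀ r, 0 < (Φ.emb r τ).im) {ξ : K₀} (hξ : ∀ r, 0 < (Φ.emb r (algebraMap K₀ K ξ)).re)
    {v : Fin 2 → ℂ} (hv : v ≠ 0) : 0 < (hForm Φ τ ξ v v).re := by
  have hterm (r : Fin 2) : (Φ.emb r (algebraMap K₀ K ξ) * v r * conj (v r) /
      ((Φ.emb r τ).im : ℂ)).re =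
      (Φ.emb r (algebraMap K₀ K ξ)).re * Complex.normSq (v r) / (Φ.emb r τ).im := by
    rw [Complex.div_ofReal_re, mul_assoc, Complex.mul_conj, Complex.re_mul_ofReal]
  rw [hForm_apply, Complex.re_sum]
  simp only [hterm]
  obtain ⟨r, hr⟩ := Function.ne_iff.mp hv
  refine Finset.sum_pos' (fun s _ => ?_) ⟨r, Finset.mem_univ r, ?_⟩
  · exact div_nonneg (mul_nonneg (hξ s).le (Complex.normSq_nonneg _)) (hτ s).le
  · exact div_pos (mul_pos (hξ r) (Complex.normSq_pos.mpr hr)) (hτ r)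

theorem hForm_surjective {Φ : CMType K} {τ : K} (hτ : ∀ r, 0 < (Φ.emb r τ).im) {ξ : K₀}
    (hξ : ξ ≠ 0) : Function.Surjective (hForm Φ τ ξ) := by
  intro f
  refine ⟨fun r => f (Pi.single r 1) * (Φ.emb r τ).im / Φ.emb r (algebraMap K₀ K ξ), ?_⟩
  ext w
  have hw : w = ∑ r, w r • (Pi.single r 1 : Fin 2 → ℂ) := by
    ext s; simp [Finset.sum_apply, Pi.single_apply]
  conv_rhs => rw [hw]
  rw [hForm_apply, map_sum]
  refine Finset.sum_congr rfl fun r _ => ?_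
  have h1 : Φ.emb r (algebraMap K₀ K ξ) ≠ 0 := by simpa using hξ
  have h2 : ((Φ.emb r τ).im : ℂ) ≠ 0 := Complex.ofReal_ne_zero.mpr (hτ r).ne'
  rw [LinearMap.map_smulₛₗ, smul_eq_mul]
  field_simp

/-- The imaginary part of `hForm`, as a `ℤ`-bilinear form. -/
noncomputable def imForm (Φ : CMType K) (τ : K) (ξ : K₀) :
    (Fin 2 → ℂ) →ₗ[ℤ] (Fin 2 → ℂ) →ₗ[ℤ] ℝ :=
  LinearMap.mk₂ ℤ (fun z w => (hForm Φ τ ξ z w).im) (by simp)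
    (fun c z w => by rw [map_zsmul]; exact map_zsmul Complex.imAddGroupHom c (hForm Φ τ ξ z w))
    (by simp)
    (fun c z w => by rw [map_zsmul]; exact map_zsmul Complex.imAddGroupHom c (hForm Φ τ ξ z w))

theorem imForm_apply (Φ : CMType K) (τ : K) (ξ : K₀) (z w : Fin 2 → ℂ) :
    imForm Φ τ ξ z w = (hForm Φ τ ξ z w).im := rfl

/-- The subgroup `ℤ` of `ℝ`. -/
def intSubgroup : AddSubgroup ℝ := AddSubgroup.zmultiples 1

theorem mem_intSubgroup {x : ℝ} : x ∈ intSubgroup ↔ ∃ n : ℤ, x = n := by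
  simp [intSubgroup, AddSubgroup.mem_zmultiples_iff, eq_comm]

theorem isIntegralOn_hForm_iff {Φ : CMType K} {τ : K} {ξ : K₀} {L : Submodule ℤ (Fin 2 → ℂ)} :
    IsIntegralOn L (hForm Φ τ ξ) ↔ ∀ v ∈ L, ∀ w ∈ L, imForm Φ τ ξ v w ∈ intSubgroup := by
  simp only [mem_intSubgroup]; rfl

end Forms

/-! ### Divisibility of tori and homomorphisms to the dual -/

section Tori

variable {V W : Type*} [AddCommGroup V] [Module ℂ V] [AddCommGroup W] [Module ℂ W]

theorem torus_nsmul_surjective (L : Submodule ℤ V) {n : ℕ} (hn : n ≠ 0) (x : Torus L) :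
    ∃ y : Torus L, n • y = x := by
  obtain ⟨v, rfl⟩ := L.mkQ_surjective x
  refine ⟨L.mkQ ((n : ℂ)⁻¹ • v), ?_⟩
  rw [← map_nsmul, ← Nat.cast_smul_eq_nsmul ℂ, smul_smul,
    mul_inv_cancel₀ (Nat.cast_ne_zero.mpr hn), one_smul]

theorem proj_surjective {L₁ L₂ : Submodule ℤ (Fin 2 → ℂ)} (h : L₁ ≤ L₂) :
    Function.Surjective (proj L₁ L₂ h) := by
  intro x
  obtain ⟨v, rfl⟩ := L₂.mkQ_surjective x
  exact ⟨L₁.mkQ v, rfl⟩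

/-- A functional integral on `L₁` becomes integral on `L₂` after multiplication by `n`, since `n L₂
⊆ L₁`. -/
theorem nsmul_eq_zero_of_dualProj_eq_zero {L₁ L₂ : Submodule ℤ (Fin 2 → ℂ)} (h : L₁ ≤ L₂) {n : ℕ}
    (hn : ∀ v ∈ L₂, n • v ∈ L₁) {x : DualTorus L₂} (hx : dualProj L₁ L₂ h x = 0) :
    n • x = 0 := by
  obtain ⟨f, rfl⟩ := (dualLattice L₂).mkQ_surjective x
  have hf : f ∈ dualLattice L₁ := (Submodule.Quotient.mk_eq_zero _).mp hx
  rw [← map_nsmul]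
  refine (Submodule.Quotient.mk_eq_zero _).mpr fun v hv => ?_
  obtain ⟨k, hk⟩ := hf _ (hn v hv)
  exact ⟨k, by rw [← hk, map_nsmul]; rfl⟩

/-- A homomorphism from `ℂ² / L₂` to its dual is determined by its pullback along an isogeny
`ℂ² / L₁ → ℂ² / L₂`. -/
theorem dualProj_comp_comp_proj_injective {L₁ L₂ : Submodule ℤ (Fin 2 → ℂ)} (h : L₁ ≤ L₂) {n : ℕ}
    (hn0 : n ≠ 0) (hn : ∀ v ∈ L₂, n • v ∈ L₁) :
    Function.Injective fun lam : Torus L₂ →ₗ[ℤ] DualTorus L₂ =>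
      dualProj L₁ L₂ h ∘ₗ lam ∘ₗ proj L₁ L₂ h := by
  intro lam mu hlm
  refine LinearMap.ext fun x => ?_
  obtain ⟨v, rfl⟩ := L₂.mkQ_surjective x
  -- At an `n`-th part `y` of the given point, `lam` and `mu` differ by `n`-torsion, so they agree
  -- at `n • y`.
  obtain ⟨y, hy⟩ := torus_nsmul_surjective L₂ hn0 (L₂.mkQ v)
  obtain ⟨z, rfl⟩ := proj_surjective h y
  have h1 := LinearMap.congr_fun hlm z
  simp only [LinearMap.comp_apply] at h1
  have h2 := nsmul_eq_zero_of_dualProj_eq_zero h hn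
    (x := lam (proj L₁ L₂ h z) - mu (proj L₁ L₂ h z)) (by rw [map_sub, h1, sub_self])
  rw [nsmul_sub, ← map_nsmul lam, ← map_nsmul mu, hy, sub_eq_zero] at h2
  exact h2

theorem formHom_injective_iff {L : Submodule ℤ V} {H : V →ₗ[ℂ] AntiDual V}
    {h : IsIntegralOn L H} :
    Function.Injective (formHom L H h) ↔ ∀ v, H v ∈ dualLattice L → v ∈ L := by
  rw [injective_iff_map_eq_zero]
  constructor
  · intro hinj v hv
    exact (Submodule.Quotient.mk_eq_zero _).mp
      (hinj (L.mkQ v) ((Submodule.Quotient.mk_eq_zero _).mpr hv))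
  · intro hH x hx
    obtain ⟨v, rfl⟩ := L.mkQ_surjective x
    exact (Submodule.Quotient.mk_eq_zero _).mpr (hH v ((Submodule.Quotient.mk_eq_zero _).mp hx))

theorem formHom_surjective {L : Submodule ℤ V} {H : V →ₗ[ℂ] AntiDual V}
    (h : IsIntegralOn L H) (hH : Function.Surjective H) : Function.Surjective (formHom L H h) := by
  intro x
  obtain ⟨f, rfl⟩ := (dualLattice L).mkQ_surjective x
  obtain ⟨v, rfl⟩ := hH f
  exact ⟨L.mkQ v, rfl⟩

end Tori

/-! ### Lattices of `α`-isogenous surfaces -/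

section Isogeny

variable {K₀ K : Type*} [Field K₀] [NumberField K₀] [Field K] [Algebra K₀ K]
  {Φ : CMType K} {ℓ : ℕ} {α : 𝓞 K₀} {L₁ L₂ : Submodule ℤ (Fin 2 → ℂ)} {hRM : HasRM K₀ Φ L₁}
  {h : L₁ ≤ L₂}

theorem proj_mk_eq_zero_iff {v : Fin 2 → ℂ} :
    (L₁.mkQ v) ∈ LinearMap.ker (proj L₁ L₂ h) ↔ v ∈ L₂ :=
  LinearMap.mem_ker.trans (Submodule.Quotient.mk_eq_zero L₂ (x := v))

theorem IsAlphaIsogeny.mulBy_mem (hI : IsAlphaIsogeny Φ ℓ α L₁ L₂ hRM h) {v : Fin 2 → ℂ}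
    (hv : v ∈ L₂) : mulBy Φ (α : K₀) v ∈ L₁ :=
  (Submodule.Quotient.mk_eq_zero L₁).mp (hI.torsion (L₁.mkQ v) (proj_mk_eq_zero_iff.mpr hv))

theorem IsAlphaIsogeny.exists_generator (hI : IsAlphaIsogeny Φ ℓ α L₁ L₂ hRM h) :
    ∃ v₀ ∈ L₂, ∀ v ∈ L₂, ∃ n : ℤ, v - n • v₀ ∈ L₁ := by
  obtain ⟨⟨g, hg⟩, hgen⟩ := hI.cyclic.exists_zsmul_surjective
  obtain ⟨v₀, rfl⟩ := L₁.mkQ_surjective g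
  refine ⟨v₀, proj_mk_eq_zero_iff.mp hg, fun v hv => ?_⟩
  obtain ⟨n, hn⟩ := hgen ⟨L₁.mkQ v, proj_mk_eq_zero_iff.mpr hv⟩
  refine ⟨n, (Submodule.Quotient.eq L₁).mp ?_⟩
  exact (congrArg Subtype.val hn).symm

theorem IsAlphaIsogeny.not_le (hI : IsAlphaIsogeny Φ ℓ α L₁ L₂ hRM h) (hℓ : ℓ ≠ 1) :
    ¬ L₂ ≤ L₁ := by
  intro hle
  apply hℓ
  have hbot : LinearMap.ker (proj L₁ L₂ h) = ⊥ := by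
    rw [eq_bot_iff]
    intro x hx
    obtain ⟨v, rfl⟩ := L₁.mkQ_surjective x
    exact (Submodule.Quotient.mk_eq_zero L₁).mpr (hle (proj_mk_eq_zero_iff.mp hx))
  have hc := hI.card
  rw [hbot] at hc
  simpa using hc.symm

theorem IsAlphaIsogeny.hasRM (hI : IsAlphaIsogeny Φ ℓ α L₁ L₂ hRM h)
    (hα : ∀ a : 𝓞 K₀, ∃ (n : ℤ) (b : 𝓞 K₀), a = n + α * b) : HasRM K₀ Φ L₂ := by
  intro a v hv
  obtain ⟨n, b, rfl⟩ := hα a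
  have h1 : mulBy Φ (((n + α * b : 𝓞 K₀)) : K₀) v =
      n • v + mulBy Φ (b : K₀) (mulBy Φ (α : K₀) v) := by
    rw [← mulBy_mul, ← mulBy_intCast (K₀ := K₀) Φ n v, ← mulBy_add, mul_comm]
    simp
  change mulBy Φ (((n + α * b : 𝓞 K₀)) : K₀) v ∈ L₂
  rw [h1]
  exact add_mem (L₂.smul_mem n hv) (h (hRM b (hI.mulBy_mem hv)))

theorem IsAlphaIsogeny.isIntegralOn [IsTotallyReal K₀]
    (hI : IsAlphaIsogeny Φ ℓ α L₁ L₂ hRM h) {τ : K} {ξ : K₀}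
    (hξ : IsIntegralOn L₁ (hForm Φ τ ξ)) : IsIntegralOn L₂ (hForm Φ τ ((α : K₀) * ξ)) := by
  rw [isIntegralOn_hForm_iff] at hξ ⊢
  obtain ⟨v₀, hv₀, hgen⟩ := hI.exists_generator
  intro v hv w hw
  obtain ⟨n, hn⟩ := hgen v hv
  obtain ⟨m, hm⟩ := hgen w hw
  have hz : imForm Φ τ ((α : K₀) * ξ) v₀ v₀ = 0 := hForm_self_im ..
  -- With `E(v₀, v₀) = 0`, each remaining term has one argument in `L₁` and the other in `L₂`;
  -- moving `α` onto the latter puts both in `L₁`.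
  have h1 : imForm Φ τ ((α : K₀) * ξ) v w =
      imForm Φ τ ((α : K₀) * ξ) v (w - m • v₀) +
        m • imForm Φ τ ((α : K₀) * ξ) (v - n • v₀) v₀ := by
    simp only [map_sub, map_zsmul, LinearMap.sub_apply, LinearMap.smul_apply, hz, smul_zero,
      sub_zero]
    abel
  rw [h1]
  refine add_mem ?_ (zsmul_mem ?_ m)
  · rw [imForm_apply, hForm_mul_left]
    exact hξ _ (hI.mulBy_mem hv) _ hm
  · rw [imForm_apply, hForm_mul_right]
    exact hξ _ hn _ (hI.mulBy_mem hv₀)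

/-- Each of `Λ₁`, `Λ₂` contributes one generator modulo `α`. Dividing by `α` gives two generators of
`α⁻¹ L₁ / L₁`. -/
theorem exists_periods_eq_zsmul_add [NumberField K] (Φ : CMType K) (τ : K)
    {Λ₁ Λ₂ : FractionalIdeal (𝓞 K₀)⁰ K₀} (hΛ₁ : Λ₁ ≠ 0) (hΛ₂ : Λ₂ ≠ 0) {α : 𝓞 K₀}
    (hmax : (Ideal.span {α}).IsMaximal)
    (hα : ∀ a : 𝓞 K₀, ∃ (n : ℤ) (b : 𝓞 K₀), a = n + α * b) :
    ∃ u₁ ∈ periods Φ Λ₁ Λ₂ τ, ∃ u₂ ∈ periods Φ Λ₁ Λ₂ τ, ∀ z ∈ periods Φ Λ₁ Λ₂ τ,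
      ∃ a b : ℤ, ∃ l ∈ periods Φ Λ₁ Λ₂ τ, z = a • u₁ + b • u₂ + mulBy Φ (α : K₀) l := by
  have hgen {I : FractionalIdeal (𝓞 K₀)⁰ K₀} (hI : I ≠ 0) :
      ∃ x ∈ I, ∀ z ∈ I, ∃ n : ℤ, ∃ y ∈ I, z = n • x + (α : K₀) * y := by
    obtain ⟨x, hx, hz⟩ := exists_mem_eq_smul_add hmax hI
    refine ⟨x, hx, fun z hzI => ?_⟩
    obtain ⟨a, y, hy, rfl⟩ := hz z hzI
    obtain ⟨n, b, rfl⟩ := hα a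
    refine ⟨n, b • x + y, (I : Submodule (𝓞 K₀) K₀).add_mem
      ((I : Submodule (𝓞 K₀) K₀).smul_mem b hx) hy, ?_⟩
    rw [← Int.cast_smul_eq_zsmul (𝓞 K₀)]
    simp only [Algebra.smul_def, map_add, map_mul]
    ring
  obtain ⟨x₁, hx₁, h₁⟩ := hgen hΛ₁
  obtain ⟨x₂, hx₂, h₂⟩ := hgen hΛ₂
  refine ⟨Φ.toVec (algebraMap K₀ K x₁), ⟨_, ⟨x₁, hx₁, 0, zero_mem _, by simp⟩, rfl⟩,
    Φ.toVec (algebraMap K₀ K x₂ * τ), ⟨_, ⟨0, zero_mem _, x₂, hx₂, by simp⟩, rfl⟩, ?_⟩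
  rintro _ ⟨_, ⟨x, hx, y, hy, rfl⟩, rfl⟩
  obtain ⟨a, x', hx', rfl⟩ := h₁ x hx
  obtain ⟨b, y', hy', rfl⟩ := h₂ y hy
  refine ⟨a, b, _, ⟨_, ⟨x', hx', y', hy', rfl⟩, rfl⟩, ?_⟩
  rw [mulBy_toVec, ← map_zsmul Φ.toVec, ← map_zsmul Φ.toVec, ← map_add Φ.toVec, ← map_add Φ.toVec]
  congr 1
  simp only [map_add, map_mul, zsmul_eq_mul, map_intCast]
  ring

/-- In `α⁻¹ L₁ / L₁`, the class of `v` is orthogonal to the line spanned by `v₀`, hence lies on it.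
-/
theorem IsAlphaIsogeny.mem_of_mem_dualLattice [IsTotallyReal K₀]
    (hI : IsAlphaIsogeny Φ ℓ α L₁ L₂ hRM h) (hℓ : ℓ.Prime) {β : 𝓞 K₀} (hαβ : α * β = (ℓ : 𝓞 K₀))
    {u₁ u₂ : Fin 2 → ℂ} (hu₁ : u₁ ∈ L₁) (hu₂ : u₂ ∈ L₁)
    (hu : ∀ z ∈ L₁, ∃ a b : ℤ, ∃ l ∈ L₁, z = a • u₁ + b • u₂ + mulBy Φ (α : K₀) l)
    {τ : K} {ξ : K₀} (hξ : IsIntegralOn L₁ (hForm Φ τ ξ))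
    (hinj : ∀ v, hForm Φ τ ξ v ∈ dualLattice L₁ → v ∈ L₁) {v : Fin 2 → ℂ}
    (hv : hForm Φ τ ((α : K₀) * ξ) v ∈ dualLattice L₂) : v ∈ L₂ := by
  have hα0 : (α : K₀) ≠ 0 := by
    intro h0
    rw [RingOfIntegers.coe_eq_zero_iff] at h0
    rw [h0, zero_mul] at hαβ
    exact hℓ.ne_zero (by exact_mod_cast hαβ.symm)
  have hinv (w : Fin 2 → ℂ) : mulBy Φ (α : K₀) (mulBy Φ (α : K₀)⁻¹ w) = w := by
    rw [← mulBy_mul, mul_inv_cancel₀ hα0, mulBy_one]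
  have hinv' (w : Fin 2 → ℂ) : mulBy Φ (α : K₀)⁻¹ (mulBy Φ (α : K₀) w) = w := by
    rw [← mulBy_mul, inv_mul_cancel₀ hα0, mulBy_one]
  -- `ℓ α⁻¹ = β` is integral, so `ℓ` kills `α⁻¹ L₁ / L₁`.
  have hℓinv (w : Fin 2 → ℂ) (hw : w ∈ L₁) : (ℓ : ℤ) • mulBy Φ (α : K₀)⁻¹ w ∈ L₁ := by
    have : (ℓ : ℤ) • mulBy Φ (α : K₀)⁻¹ w = mulBy Φ (β : K₀) w := by
      rw [← mulBy_intCast (K₀ := K₀) Φ, ← mulBy_mul]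
      congr 2
      have h1 : ((ℓ : ℤ) : K₀) = (α : K₀) * β := by
        rw [← map_mul, hαβ]; simp
      rw [h1]; field_simp
    rw [this]
    exact hRM β hw
  obtain ⟨v₀, hv₀, hgen⟩ := hI.exists_generator
  have hv₀L : v₀ ∉ L₁ := fun hmem => hI.not_le hℓ.ne_one fun w hw => by
    obtain ⟨n, hn⟩ := hgen w hw
    have := add_mem hn (L₁.smul_mem n hmem)
    rwa [sub_add_cancel] at this
  rw [isIntegralOn_hForm_iff] at hξ
  obtain ⟨n, hn⟩ := exists_sub_zsmul_mem_of_alternating hℓ (imForm Φ τ ((α : K₀) * ξ))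
    (fun w => hForm_self_im ..) intSubgroup L₁ (hℓinv u₁ hu₁) (hℓinv u₂ hu₂)
    (N := L₁.comap ((mulBy Φ (α : K₀)).restrictScalars ℤ))
    (show mulBy Φ (α : K₀) (mulBy Φ (α : K₀)⁻¹ u₁) ∈ L₁ by rwa [hinv])
    (show mulBy Φ (α : K₀) (mulBy Φ (α : K₀)⁻¹ u₂) ∈ L₁ by rwa [hinv])
    (hRM α) (v := v) (w := v₀)
    (fun w hw => by
      obtain ⟨a, b, l, hl, hw'⟩ := hu _ hw
      refine ⟨a, b, l, hl, ?_⟩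
      have h1 := congrArg (mulBy Φ (α : K₀)⁻¹) hw'
      rw [map_add, map_add, map_zsmul, map_zsmul, hinv'] at h1
      exact (hinv' w).symm.trans h1)
    (fun w hw l hl => by
      rw [imForm_apply, hForm_mul_left]
      exact hξ _ hw _ hl)
    -- `α v ∈ L₁` by self-duality of `L₁`, as `E_ξ(α v, w) = E_{αξ}(v, w)` is integral for `w ∈ L₁ ⊆
    -- L₂`.
    (hinj _ fun w hw => by
      obtain ⟨k, hk⟩ := hv w (h hw)
      exact ⟨k, by rw [← hk, hForm_mul_left]; rfl⟩)
    (hI.mulBy_mem hv₀)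
    -- If `v₀` paired integrally with all of `α⁻¹ L₁`, then `E_ξ(v₀, ·)` would be integral on `L₁`,
    -- forcing `v₀ ∈ L₁`.
    (by
      by_contra! hcon
      refine hv₀L (hinj _ fun w hw => ?_)
      have := hcon (mulBy Φ (α : K₀)⁻¹ w)
        (show mulBy Φ (α : K₀) (mulBy Φ (α : K₀)⁻¹ w) ∈ L₁ by rwa [hinv])
      rw [imForm_apply, hForm_mul_right, hinv] at this
      exact mem_intSubgroup.mp this)
    (mem_intSubgroup.mpr (hv v₀ hv₀))
  have := add_mem (h hn) (L₂.smul_mem n hv₀)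
  rwa [sub_add_cancel] at this

theorem dualProj_comp_formHom_comp_proj [IsTotallyReal K₀] {β : 𝓞 K₀}
    (hαβ : α * β = (ℓ : 𝓞 K₀)) {τ : K} {ξ : K₀}
    (hξ : IsIntegralOn L₁ (hForm Φ τ ξ)) (hRM₂ : HasRM K₀ Φ L₂)
    (hint : IsIntegralOn L₂ (hForm Φ τ ((α : K₀) * ξ))) :
    dualProj L₁ L₂ h ∘ₗ (rmEndDual Φ L₂ hRM₂ β ∘ₗ formHom L₂ (hForm Φ τ ((α : K₀) * ξ)) hint) ∘ₗ
      proj L₁ L₂ h = (ℓ : ℤ) • formHom L₁ (hForm Φ τ ξ) hξ := by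
  refine LinearMap.ext fun x => ?_
  obtain ⟨v, rfl⟩ := L₁.mkQ_surjective x
  change (dualLattice L₁).mkQ (antiTranspose LinearMap.id (antiTranspose (mulBy Φ (β : K₀))
    (hForm Φ τ ((α : K₀) * ξ) v))) = (ℓ : ℤ) • (dualLattice L₁).mkQ (hForm Φ τ ξ v)
  rw [← map_zsmul]
  congr 1
  ext1 w
  change hForm Φ τ ((α : K₀) * ξ) v (mulBy Φ (β : K₀) w) = (ℓ : ℤ) • hForm Φ τ ξ v w
  rw [← hForm_mul_right, ← mul_assoc, mul_comm (β : K₀), ← map_mul, hαβ, hForm_mul_left, map_natCast,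
    ← Int.cast_natCast (R := K₀), mulBy_intCast, map_zsmul]
  rfl

end Isogeny
end RMIsogeny

/-! ### The main theorem -/

open RMIsogeny in
theorem mainTheorem10 {K₀ K : Type*} [Field K₀] [NumberField K₀] [IsTotallyReal K₀]
    [Field K] [NumberField K] [IsTotallyComplex K] [Algebra K₀ K]
    [Algebra.IsQuadraticExtension K₀ K] (hdeg : Module.finrank ℚ K₀ = 2)
    -- the surface `J₁ = ℂ² / Φ(Λ₁ + Λ₂ τ)`
    (Φ : CMType K) (τ : K) (hτ : ∀ r, 0 < (Φ.emb r τ).im)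
    (Λ₁ Λ₂ : FractionalIdeal (𝓞 K₀)⁰ K₀) (hΛ₁ : Λ₁ ≠ 0) (hΛ₂ : Λ₂ ≠ 0)
    -- the prime `ℓ`, its factorization, and the generators `α₁`, `α₂`
    (ℓ : ℕ) (hℓ : ℓ.Prime) (𝔩₁ 𝔩₂ : Ideal (𝓞 K₀)) (h𝔩₁ : 𝔩₁.IsPrime) (h𝔩₂ : 𝔩₂.IsPrime)
    (hsplit : Ideal.span {(ℓ : 𝓞 K₀)} = 𝔩₁ * 𝔩₂)
    (α₁ α₂ : 𝓞 K₀) (hα₁ : 𝔩₁ = Ideal.span {α₁}) (hα₂ : 𝔩₂ = Ideal.span {α₂})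
    (hα : α₁ * α₂ = (ℓ : 𝓞 K₀))
    -- the polarization of `J₁` attached to `ξ`
    (ξ : K₀) (hξ : IsRiemannForm (periods Φ Λ₁ Λ₂ τ) (hForm Φ τ ξ))
    -- the `α₁`-isogeny `I : J₁ → J₂ = ℂ² / L₂`
    (L₂ : Submodule ℤ (Fin 2 → ℂ)) (hL : periods Φ Λ₁ Λ₂ τ ≤ L₂)
    (hI : IsAlphaIsogeny Φ ℓ α₁ (periods Φ Λ₁ Λ₂ τ) L₂ (hasRM_periods Φ Λ₁ Λ₂ τ) hL) :
    ∃ (hRM : HasRM K₀ Φ L₂) (hint : IsIntegralOn L₂ (hForm Φ τ ((α₁ : K₀) * ξ))),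
      (∀ lam : Torus L₂ →ₗ[ℤ] DualTorus L₂,
        dualProj (periods Φ Λ₁ Λ₂ τ) L₂ hL ∘ₗ lam ∘ₗ proj (periods Φ Λ₁ Λ₂ τ) L₂ hL =
            (ℓ : ℤ) • formHom (periods Φ Λ₁ Λ₂ τ) (hForm Φ τ ξ) hξ.integral ↔
          lam = rmEndDual Φ L₂ hRM α₂ ∘ₗ formHom L₂ (hForm Φ τ ((α₁ : K₀) * ξ)) hint) ∧
      (IsTotallyPos (α₁ : K₀) → IsRiemannForm L₂ (hForm Φ τ ((α₁ : K₀) * ξ))) ∧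
      (Function.Bijective (formHom (periods Φ Λ₁ Λ₂ τ) (hForm Φ τ ξ) hξ.integral) →
        Function.Bijective (formHom L₂ (hForm Φ τ ((α₁ : K₀) * ξ)) hint)) := by
  have hmax : (Ideal.span {α₁}).IsMaximal := by
    refine hα₁ ▸ h𝔩₁.isMaximal ?_
    rintro rfl
    rw [Ideal.bot_mul, Ideal.span_singleton_eq_bot] at hsplit
    exact hℓ.ne_zero (by exact_mod_cast hsplit)
  have hcard : Nat.card (𝓞 K₀ ⧸ Ideal.span {α₁}) = ℓ :=
    hα₁ ▸ absNorm_eq_of_mul_eq_span hdeg hℓ h𝔩₁.ne_top h𝔩₂.ne_top hsplit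
  have hres := exists_int_add_mul_of_card_prime hℓ α₁ hcard
  have hRM := hI.hasRM hres
  have hint := hI.isIntegralOn hξ.integral
  have hα₁0 : (α₁ : K₀) ≠ 0 := by
    intro h0
    rw [RingOfIntegers.coe_eq_zero_iff] at h0
    rw [h0, zero_mul] at hα
    exact hℓ.ne_zero (by exact_mod_cast hα.symm)
  have hξpos := emb_re_pos_of_isRiemannForm hξ hτ
  have hξ0 : ξ ≠ 0 := by
    rintro rfl
    simpa using hξpos 0
  refine ⟨hRM, hint, fun lam => ?_, fun hpos => ⟨hForm_conj Φ τ _, fun v hv => ?_, hint⟩,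
    fun hbij => ⟨?_, formHom_surjective hint (hForm_surjective hτ (mul_ne_zero hα₁0 hξ0))⟩⟩
  · have hcomp := dualProj_comp_formHom_comp_proj (h := hL) hα hξ.integral hRM hint
    refine ⟨fun hlam => ?_, fun hlam => hlam ▸ hcomp⟩
    refine dualProj_comp_comp_proj_injective hL hℓ.ne_zero (fun v hv => ?_) (hlam.trans hcomp.symm)
    -- `ℓ L₂ = α₂ α₁ L₂ ⊆ α₂ L₁ ⊆ L₁`, the torsion bound needed for uniqueness.
    have h1 := hasRM_periods Φ Λ₁ Λ₂ τ α₂ (hI.mulBy_mem hv)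
    change mulBy Φ (α₂ : K₀) (mulBy Φ (α₁ : K₀) v) ∈ periods Φ Λ₁ Λ₂ τ at h1
    rwa [← mulBy_mul, mul_comm, ← map_mul, hα, map_natCast, ← Int.cast_natCast (R := K₀),
      mulBy_intCast, natCast_zsmul] at h1
  · refine hForm_pos hτ (fun r => ?_) hv
    rw [map_mul, map_mul, Complex.mul_re,
      Complex.conj_eq_iff_im.mp (conj_emb_algebraMap Φ r (α₁ : K₀)), zero_mul, sub_zero]
    exact mul_pos (emb_re_pos_of_isTotallyPos Φ hpos r) (hξpos r)
  · obtain ⟨u₁, hu₁, u₂, hu₂, hu⟩ := exists_periods_eq_zsmul_add Φ τ hΛ₁ hΛ₂ hmax hres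
    exact formHom_injective_iff.mpr fun v hv => hI.mem_of_mem_dualLattice hℓ hα hu₁ hu₂ hu
      hξ.integral (formHom_injective_iff.mp hbij.injective) hv
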